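/- Let $n\ge 0$ be an integer and let $\varphi:\mathbb R^n\to\mathbb R$ be a $C^1$, strictly convex function such that $\lim_{|x|\to\infty}\varphi(x)/|x|=\infty$ ($|\cdot|$ the Euclidean norm) and $\int_{\mathbb R^n}e^{-\varphi(x)}\,dx=1$. Let $\mu_\varphi$ be the probability measure $\mu_\varphi(dx)=e^{-\varphi(x)}\,dx$, let $$\varphi^*(x)=\sup_{z\in\mathbb R^n}\{x\cdot z-\varphi(z)\}$$ be the Fenchel–Legendre transform of $\varphi$ (which is finite everywhere), and write $$\mathrm{Ent}_{\mu_\varphi}(e^g)=\int e^{g}\log\frac{e^g}{\int e^g\,d\mu_\varphi}\,d\mu_\varphi .$$ Then for every $C^1$ function $g:\mathbb R^n\to\mathbb R$ such that the integrals involved exist, that is, such that $e^g$, $g\,e^g$ and $x\mapsto\bigl[x\cdot\nabla g(x)-\varphi^*(\nabla\varphi(x))+\varphi^*(\nabla\varphi(x)-\nabla g(x))\bigr]e^{g(x)}$ are $\mu_\varphi$-integrable, $$\mathrm{Ent}_{\mu_\varphi}(e^g)\le\int_{\mathbb R^n}\Bigl[x\cdot\nabla g(x)-\varphi^*(\nabla\varphi(x))+\varphi^*\bigl(\nabla\varphi(x)-\nabla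 g(x)\bigr)\Bigr]e^{g(x)}\,d\mu_\varphi(x).$$ -/

import Mathlib

open MeasureTheory Filter Topology
open scoped Gradient

/-- The Fenchel-Legendre transform `φ*(x) = sup_z (x · z - φ z)` of a real function on `ℝⁿ`. -/
noncomputable def legendreTransform {n : ℕ} (φ : EuclideanSpace ℝ (Fin n) → ℝ)
    (x : EuclideanSpace ℝ (Fin n)) : ℝ :=
  ⨆ z : EuclideanSpace ℝ (Fin n), (inner ℝ x z - φ z)

/-- The measure `μ_φ(dx) = e^{-φ(x)} dx` on `ℝⁿ`. -/
noncomputable def expMeasure {n : ℕ} (φ : EuclideanSpace ℝ (Fin n) → ℝ) :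
    Measure (EuclideanSpace ℝ (Fin n)) :=
  volume.withDensity (fun x => ENNReal.ofReal (Real.exp (-φ x)))

/-- The entropy `Ent_μ(f) = ∫ f log (f / ∫ f dμ) dμ` of a positive function `f`. -/
noncomputable def entropy {α : Type*} [MeasurableSpace α] (μ : Measure α) (f : α → ℝ) : ℝ :=
  ∫ x, f x * Real.log (f x / ∫ y, f y ∂μ) ∂μ

/-- `lim φ(x) / ‖x‖ = ∞` as `‖x‖ → ∞`. -/
def IsSuperlinear {n : ℕ} (φ : EuclideanSpace ℝ (Fin n) → ℝ) : Prop :=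
  Tendsto (fun x => φ x / ‖x‖) (Bornology.cobounded (EuclideanSpace ℝ (Fin n))) atTop

/-- For a continuous superlinear function the supremum defining the Legendre transform is over a
bounded set, so that the real-valued supremum is the true one. -/
theorem bddAbove_range_legendre {n : ℕ} {φ : EuclideanSpace ℝ (Fin n) → ℝ}
    (hc : Continuous φ) (hφ : IsSuperlinear φ) (x : EuclideanSpace ℝ (Fin n)) :
    BddAbove (Set.range fun z : EuclideanSpace ℝ (Fin n) => inner ℝ x z - φ z) := by
  have h1 := hφ.eventually (eventually_ge_atTop ‖x‖)
  have h2 : Continuous fun z : EuclideanSpace ℝ (Fin n) => inner ℝ x z - φ z := by fun_prop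
  obtain ⟨R, hR⟩ := (Filter.hasBasis_cobounded_norm (E := EuclideanSpace ℝ (Fin n))).eventually_iff.1 h1
  obtain ⟨C, hC⟩ := (isCompact_closedBall (0 : EuclideanSpace ℝ (Fin n)) (max R 1)).bddAbove_image
    h2.continuousOn
  refine ⟨max C 0, ?_⟩
  rintro _ ⟨z, rfl⟩
  by_cases hz : ‖z‖ ≤ max R 1
  · exact le_max_of_le_left (hC ⟨z, by simpa using hz, rfl⟩)
  · push Not at hz
    have hz0 : 0 < ‖z‖ := lt_trans one_pos (lt_of_le_of_lt (le_max_right _ _) hz)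
    have h3 := hR.2 (show R ≤ ‖z‖ from (lt_of_le_of_lt (le_max_left _ _) hz).le)
    rw [le_div_iff₀ hz0] at h3
    exact le_max_of_le_right (by linarith [real_inner_le_norm x z])

/-! The inequality is the derivative at `t = 0` of the Prékopa-Leindler inequality. Put `f = φ - g`,
so that `e^{-f} dx = e^g dμ_φ`, and apply `prekopaLeindler` to `F = e^{-f}`, `G = e^{-φ}` and the
supremum of `F(x)^{1-t} G(y)^t` over `(1-t)x + ty = z`. To first order in `t` the quantity inside
this supremum is `F + t(-F log F - φ(y) F + dF(z - y))`, and the supremum over `y` turns the bracket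
into `(f - z·∇f + φ*(∇f)) e^{-f}`. On the other side, `(∫F)^{1-t} (∫G)^t` has derivative `-Z log Z`
at `0`, where `Z = ∫F` and `∫G = 1`. Comparing derivatives gives `neg_integral_mul_log_integral_le`;
the identity `φ*(∇φ) = x·∇φ - φ`, where convexity enters, rewrites it as the entropy bound.

The expansion must be uniform in `z` and `y`, so `F` is first cut off to compact support and `G`
restricted to a ball (`eventually_rpow_mul_exp_le`, `mul_log_sub_log_le_integral`); dominated
convergence then removes the cutoff. -/

/-! ### Brunn-Minkowski and Prékopa-Leindler -/

/-- The translates `A + min B` and `max A + B` both lie in `C` and meet only at the point `max A +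
min B`, which is null. -/
theorem volume_add_volume_le_of_isCompact {A B C : Set ℝ} (hA : IsCompact A) (hB : IsCompact B)
    (hA' : A.Nonempty) (hB' : B.Nonempty) (h : ∀ a ∈ A, ∀ b ∈ B, a + b ∈ C) :
    volume A + volume B ≤ volume C := by
  set a₀ := sSup A
  set b₀ := sInf B
  have ha₀ : a₀ ∈ A := hA.sSup_mem hA'
  have hb₀ : b₀ ∈ B := hB.sInf_mem hB'
  rw [← measure_inter_add_sdiff C (measurableSet_Iic (a := a₀ + b₀))]
  refine add_le_add ?_ ?_
  · calc volume A = volume ((fun x => x + b₀) '' A) := by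
          rw [Set.image_add_right, measure_preimage_add_right]
      _ ≤ volume (C ∩ Set.Iic (a₀ + b₀)) := by
          refine measure_mono ?_
          rintro _ ⟨a, ha, rfl⟩
          exact ⟨h a ha b₀ hb₀, by simpa using le_csSup hA.bddAbove ha⟩
  · calc volume B = volume ((fun x => a₀ + x) '' B) := by
          rw [Set.image_add_left, measure_preimage_add]
      _ = volume (((fun x => a₀ + x) '' B) \ {a₀ + b₀}) :=
          (measure_sdiff_null (by simp)).symm
      _ ≤ volume (C \ Set.Iic (a₀ + b₀)) := by
          refine measure_mono ?_
          rintro _ ⟨⟨b, hb, rfl⟩, hne⟩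
          refine ⟨h a₀ ha₀ b hb, ?_⟩
          have h1 : b₀ ≤ b := csInf_le hB.bddBelow hb
          have h2 : b₀ ≠ b := fun h => hne (by simp [h])
          simpa using lt_of_le_of_ne h1 h2

/-- The Brunn-Minkowski inequality on the line. -/
theorem volume_add_volume_le {A B C : Set ℝ} (hA : MeasurableSet A) (hB : MeasurableSet B)
    (hA' : A.Nonempty) (hB' : B.Nonempty) (h : ∀ a ∈ A, ∀ b ∈ B, a + b ∈ C) :
    volume A + volume B ≤ volume C := by
  obtain ⟨a, ha⟩ := hA'
  obtain ⟨b, hb⟩ := hB'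
  have key : ∀ K ⊆ A, IsCompact K → ∀ L ⊆ B, IsCompact L → volume K + volume L ≤ volume C := by
    intro K hK hKc L hL hLc
    -- The compact sets `K` and `L` may be empty; inserting `a` and `b` makes the compact case
    -- applicable.
    refine le_trans (add_le_add (measure_mono (Set.subset_insert a K))
      (measure_mono (Set.subset_insert b L))) ?_
    refine volume_add_volume_le_of_isCompact (hKc.insert a) (hLc.insert b) (by simp) (by simp) ?_
    intro x hx y hy
    exact h x (Set.insert_subset ha hK hx) y (Set.insert_subset hb hL hy)
  rw [hA.measure_eq_iSup_isCompact, hB.measure_eq_iSup_isCompact]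
  simp only [iSup_and']
  refine ENNReal.biSup_add_biSup_le' ⟨∅, by simp⟩ ⟨∅, by simp⟩ ?_
  rintro K ⟨hK, hKc⟩ L ⟨hL, hLc⟩
  exact key K hK hKc L hL hLc

theorem volume_weighted_add_le {A B C : Set ℝ} {t : ℝ} (ht0 : 0 < t) (ht1 : t < 1)
    (hA : MeasurableSet A) (hB : MeasurableSet B)
    (hA' : A.Nonempty) (hB' : B.Nonempty) (h : ∀ a ∈ A, ∀ b ∈ B, (1 - t) * a + t * b ∈ C) :
    ENNReal.ofReal (1 - t) * volume A + ENNReal.ofReal t * volume B ≤ volume C := by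
  have h1 : 0 < 1 - t := by linarith
  have e1 := Measure.addHaar_smul (volume : Measure ℝ) (1 - t) A
  have e2 := Measure.addHaar_smul (volume : Measure ℝ) t B
  simp only [Module.finrank_self, pow_one, abs_of_pos h1, abs_of_pos ht0] at e1 e2
  rw [← e1, ← e2]
  refine volume_add_volume_le (hA.const_smul₀ _) (hB.const_smul₀ _) (hA'.smul_set) (hB'.smul_set) ?_
  rintro _ ⟨a, ha, rfl⟩ _ ⟨b, hb, rfl⟩
  exact h a ha b hb

theorem lintegral_eq_lintegral_Ioo_meas_lt {f : ℝ → ℝ} (hf : Measurable f) (hf0 : ∀ x, 0 ≤ f x)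
    (hf1 : ∀ x, f x ≤ 1) :
    ∫⁻ x, ENNReal.ofReal (f x) = ∫⁻ s in Set.Ioo (0 : ℝ) 1, volume {x | s < f x} := by
  rw [lintegral_eq_lintegral_meas_lt _ (ae_of_all _ hf0) hf.aemeasurable]
  rw [← Set.Ioo_union_Ici_eq_Ioi (zero_lt_one (α := ℝ)), lintegral_union measurableSet_Ici]
  · rw [setLIntegral_congr_fun (g := fun _ => 0) measurableSet_Ici, lintegral_zero, add_zero]
    intro s hs
    have : {x | s < f x} = ∅ := by
      ext x
      simpa using (hf1 x).trans hs
    simp [this]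
  · exact Set.disjoint_left.2 fun x hx hx' => absurd hx.2 (not_lt.2 hx')

/-- The Prékopa-Leindler inequality on the line for functions with supremum `1`, in its
arithmetic form. -/
theorem prekopaLeindler_real_normalized {f g h : ℝ → ℝ} {t : ℝ} (ht0 : 0 < t) (ht1 : t < 1)
    (hf : Measurable f) (hg : Measurable g) (hh : Measurable h)
    (hf0 : ∀ x, 0 ≤ f x) (hg0 : ∀ x, 0 ≤ g x) (hh0 : ∀ x, 0 ≤ h x)
    (hf1 : ∀ x, f x ≤ 1) (hg1 : ∀ x, g x ≤ 1) (hf_sup : ∀ s < 1, ∃ x, s < f x)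
    (hg_sup : ∀ s < 1, ∃ x, s < g x)
    (hfgh : ∀ s, 0 < s → s < 1 → ∀ x y, s < f x → s < g y → s < h ((1 - t) * x + t * y)) :
    ENNReal.ofReal (1 - t) * (∫⁻ x, ENNReal.ofReal (f x)) + ENNReal.ofReal t *
      (∫⁻ x, ENNReal.ofReal (g x)) ≤ ∫⁻ x, ENNReal.ofReal (h x) := by
  -- Capping `h` at `1` keeps its superlevel sets at levels below `1`, and all three layer-cake
  -- integrals then run over `(0, 1)`.
  have hle : ∫⁻ x, ENNReal.ofReal (min (h x) 1) ≤ ∫⁻ x, ENNReal.ofReal (h x) :=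
    lintegral_mono fun x => ENNReal.ofReal_le_ofReal (min_le_left _ _)
  refine le_trans ?_ hle
  rw [lintegral_eq_lintegral_Ioo_meas_lt hf hf0 hf1, lintegral_eq_lintegral_Ioo_meas_lt hg hg0 hg1,
    lintegral_eq_lintegral_Ioo_meas_lt (hh.min measurable_const)
      (fun x => le_min (hh0 x) zero_le_one) (fun x => min_le_right _ _)]
  have m : ∀ u : ℝ → ℝ, Measurable fun s => volume {x | s < u x} := fun u =>
    Antitone.measurable fun a b hab => measure_mono fun x hx => lt_of_le_of_lt hab hx
  rw [← lintegral_const_mul _ (m f), ← lintegral_const_mul _ (m g),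
    ← lintegral_add_left ((m f).const_mul _)]
  refine setLIntegral_mono (m _) fun s hs => ?_
  -- Having supremum `1` makes the superlevel sets of `f` and `g` nonempty at every level `s < 1`,
  -- as Brunn-Minkowski requires.
  refine volume_weighted_add_le ht0 ht1 (measurableSet_lt measurable_const hf)
    (measurableSet_lt measurable_const hg) (hf_sup s hs.2) (hg_sup s hs.2) ?_
  intro x hx y hy
  exact lt_min (hfgh s hs.1 hs.2 x y hx hy) hs.2

theorem ENNReal.rpow_mul_rpow_le_weighted_add {t : ℝ} (ht0 : 0 < t) (ht1 : t < 1)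
    (a b : ENNReal) :
    a ^ (1 - t) * b ^ t ≤ ENNReal.ofReal (1 - t) * a + ENNReal.ofReal t * b := by
  have h1 : 0 < 1 - t := by linarith
  rcases eq_or_ne a ⊤ with rfl | ha
  · rw [ENNReal.mul_top (by simpa using ht1)]; simp
  rcases eq_or_ne b ⊤ with rfl | hb
  · rw [ENNReal.mul_top (by simpa using ht0)]; simp
  lift a to NNReal using ha
  lift b to NNReal using hb
  have := NNReal.geom_mean_le_arith_mean2_weighted (1 - t).toNNReal t.toNNReal a b
    (by rw [← Real.toNNReal_add h1.le ht0.le]; simp)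
  rw [Real.coe_toNNReal _ h1.le, Real.coe_toNNReal _ ht0.le] at this
  rw [← ENNReal.coe_rpow_of_nonneg _ h1.le, ← ENNReal.coe_rpow_of_nonneg _ ht0.le,
    ENNReal.ofReal, ENNReal.ofReal]
  exact_mod_cast this

theorem prekopaLeindler_real_of_iSup_eq_one {F G H : ℝ → ENNReal} {t : ℝ} (ht0 : 0 < t)
    (ht1 : t < 1) (hF : Measurable F) (hG : Measurable G) (hH : Measurable H)
    (hF1 : ⨆ x, F x = 1) (hG1 : ⨆ x, G x = 1)
    (h : ∀ x y, F x ^ (1 - t) * G y ^ t ≤ H ((1 - t) * x + t * y)) :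
    (∫⁻ x, F x) ^ (1 - t) * (∫⁻ x, G x) ^ t ≤ ∫⁻ x, H x := by
  have h1 : 0 < 1 - t := by linarith
  have hFle : ∀ x, F x ≤ 1 := fun x => hF1 ▸ le_iSup F x
  have hGle : ∀ x, G x ≤ 1 := fun x => hG1 ▸ le_iSup G x
  have hFt : ∀ x, F x ≠ ⊤ := fun x => ((hFle x).trans_lt ENNReal.one_lt_top).ne
  have hGt : ∀ x, G x ≠ ⊤ := fun x => ((hGle x).trans_lt ENNReal.one_lt_top).ne
  have hHt : ∀ x, min (H x) 1 ≠ ⊤ := fun x =>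
    ((min_le_right _ _).trans_lt ENNReal.one_lt_top).ne
  have sup : ∀ U : ℝ → ENNReal, (⨆ x, U x = 1) → (∀ x, U x ≠ ⊤) →
      ∀ s < 1, ∃ x, s < (U x).toReal := by
    intro U hU hUt s hs
    have : ENNReal.ofReal (max s 0) < ⨆ x, U x := by
      rw [hU]; simpa using hs
    obtain ⟨x, hx⟩ := lt_iSup_iff.1 this
    refine ⟨x, lt_of_le_of_lt (le_max_left s 0) ?_⟩
    exact (ENNReal.ofReal_lt_iff_lt_toReal (le_max_right _ _) (hUt x)).1 hx
  have key := prekopaLeindler_real_normalized ht0 ht1 hF.ennreal_toReal hG.ennreal_toReal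
    (hH.min (measurable_const (a := (1 : ENNReal)))).ennreal_toReal (fun x => ENNReal.toReal_nonneg)
    (fun x => ENNReal.toReal_nonneg) (fun x => ENNReal.toReal_nonneg)
    (fun x => ENNReal.toReal_le_of_le_ofReal zero_le_one (by simpa using hFle x))
    (fun x => ENNReal.toReal_le_of_le_ofReal zero_le_one (by simpa using hGle x))
    (sup F hF1 hFt) (sup G hG1 hGt) ?_
  · simp only [ENNReal.ofReal_toReal (hFt _), ENNReal.ofReal_toReal (hGt _),
      ENNReal.ofReal_toReal (hHt _)] at key
    exact (ENNReal.rpow_mul_rpow_le_weighted_add ht0 ht1 _ _).trans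
      (key.trans (lintegral_mono fun x => min_le_left _ _))
  · intro s hs0 hs1 x y hx hy
    rw [← ENNReal.ofReal_lt_iff_lt_toReal hs0.le (hFt x)] at hx
    rw [← ENNReal.ofReal_lt_iff_lt_toReal hs0.le (hGt y)] at hy
    rw [← ENNReal.ofReal_lt_iff_lt_toReal hs0.le (hHt _)]
    refine lt_min (lt_of_lt_of_le ?_ (h x y)) (by simpa using hs1)
    -- The exponents sum to `1`, so the multiplicative hypothesis maps level `s` of `F` and `G` to
    -- level `s` of `H`.
    calc ENNReal.ofReal s = ENNReal.ofReal s ^ (1 - t) * ENNReal.ofReal s ^ t := by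
          rw [← ENNReal.rpow_add _ _ (by simpa using hs0) ENNReal.ofReal_ne_top]; simp
      _ < F x ^ (1 - t) * G y ^ t :=
          ENNReal.mul_lt_mul (ENNReal.rpow_lt_rpow hx h1) (ENNReal.rpow_lt_rpow hy ht0)

/-- By homogeneity: divide `F` and `G` by their suprema `a` and `b`, and `H` by `a^{1-t} b^t`. If a
supremum vanishes, so does the left side. -/
theorem prekopaLeindler_real_of_bounded {F G H : ℝ → ENNReal} {t : ℝ} (ht0 : 0 < t) (ht1 : t < 1)
    (hF : Measurable F) (hG : Measurable G) (hH : Measurable H)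
    (hFb : ⨆ x, F x ≠ ⊤) (hGb : ⨆ x, G x ≠ ⊤)
    (h : ∀ x y, F x ^ (1 - t) * G y ^ t ≤ H ((1 - t) * x + t * y)) :
    (∫⁻ x, F x) ^ (1 - t) * (∫⁻ x, G x) ^ t ≤ ∫⁻ x, H x := by
  have h1 : 0 < 1 - t := by linarith
  rcases eq_or_ne (⨆ x, F x) 0 with ha | ha
  · have : ∀ x, F x = 0 := by simpa using ha
    simp [this, h1]
  rcases eq_or_ne (⨆ x, G x) 0 with hb | hb
  · have : ∀ x, G x = 0 := by simpa using hb
    simp [this, ht0]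
  set a := ⨆ x, F x with ha_def
  set b := ⨆ x, G x with hb_def
  have key := prekopaLeindler_real_of_iSup_eq_one ht0 ht1 (hF.const_mul a⁻¹) (hG.const_mul b⁻¹)
    (hH.const_mul (a⁻¹ ^ (1 - t) * b⁻¹ ^ t))
    (by rw [← ENNReal.mul_iSup, ← ha_def, ENNReal.inv_mul_cancel ha hFb])
    (by rw [← ENNReal.mul_iSup, ← hb_def, ENNReal.inv_mul_cancel hb hGb])
    (fun x y => by
      rw [ENNReal.mul_rpow_of_nonneg _ _ h1.le, ENNReal.mul_rpow_of_nonneg _ _ ht0.le,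
        mul_mul_mul_comm]
      gcongr
      exact h x y)
  rw [lintegral_const_mul _ hF, lintegral_const_mul _ hG, lintegral_const_mul _ hH,
    ENNReal.mul_rpow_of_nonneg _ _ h1.le, ENNReal.mul_rpow_of_nonneg _ _ ht0.le,
    mul_mul_mul_comm] at key
  refine (ENNReal.mul_le_mul_iff_right ?_ ?_).1 key
  · simp [ENNReal.rpow_eq_zero_iff, hFb, hGb, ha, hb]
  · simp [ENNReal.mul_eq_top, ENNReal.rpow_eq_top_iff, hFb, hGb, ha, hb]

/-- The Prékopa-Leindler inequality on the line. -/
theorem prekopaLeindler_real {F G H : ℝ → ENNReal} {t : ℝ} (ht0 : 0 < t) (ht1 : t < 1)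
    (hF : Measurable F) (hG : Measurable G) (hH : Measurable H)
    (h : ∀ x y, F x ^ (1 - t) * G y ^ t ≤ H ((1 - t) * x + t * y)) :
    (∫⁻ x, F x) ^ (1 - t) * (∫⁻ x, G x) ^ t ≤ ∫⁻ x, H x := by
  have h1 : 0 < 1 - t := by linarith
  -- Truncation at height `k` reduces to bounded functions; monotone convergence recovers the
  -- integral.
  have lim : ∀ U : ℝ → ENNReal, Measurable U →
      ⨆ k : ℕ, ∫⁻ x, min (U x) k = ∫⁻ x, U x := by
    intro U hU
    rw [← lintegral_iSup (fun k => hU.min measurable_const)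
      (fun i j hij x => min_le_min le_rfl (by exact_mod_cast hij))]
    congr with x
    refine le_antisymm (iSup_le fun k => min_le_left _ _) ?_
    refine le_of_forall_lt fun c hc => ?_
    obtain ⟨k, hk⟩ := ENNReal.exists_nat_gt hc.ne_top
    exact lt_of_lt_of_le (lt_min hc hk) (le_iSup (fun k : ℕ => min (U x) k) k)
  have mono : ∀ U : ℝ → ENNReal, Monotone fun k : ℕ => ∫⁻ x, min (U x) k := fun U i j hij =>
    lintegral_mono fun x => min_le_min le_rfl (by exact_mod_cast hij)
  have step : ∀ k l : ℕ, (∫⁻ x, min (F x) k) ^ (1 - t) * (∫⁻ x, min (G x) l) ^ t ≤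
      ∫⁻ x, H x := by
    intro k l
    refine prekopaLeindler_real_of_bounded ht0 ht1 (hF.min measurable_const)
      (hG.min measurable_const) hH ?_ ?_ ?_
    · exact ((iSup_le fun x => min_le_right _ _).trans_lt (ENNReal.natCast_lt_top k)).ne
    · exact ((iSup_le fun x => min_le_right _ _).trans_lt (ENNReal.natCast_lt_top l)).ne
    · intro x y
      refine le_trans ?_ (h x y)
      gcongr <;> exact min_le_left _ _
  have e : ∀ (u : ℕ → ENNReal) (p : ℝ), 0 < p → (⨆ k, u k) ^ p = ⨆ k, u k ^ p := by
    intro u p hp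
    exact (ENNReal.orderIsoRpow p hp).map_iSup u
  rw [← lim F hF, ← lim G hG, e _ _ h1, e _ _ ht0, ENNReal.iSup_mul]
  refine iSup_le fun k => ?_
  rw [ENNReal.mul_iSup]
  exact iSup_le fun l => step k l

/-- Induction by slicing: the inequality for slices at fixed first coordinates is exactly the
hypothesis of the one-dimensional inequality for the partial integrals. -/
theorem prekopaLeindler_pi {t : ℝ} (ht0 : 0 < t) (ht1 : t < 1) : ∀ (n : ℕ)
    {F G H : (Fin n → ℝ) → ENNReal} (_ : Measurable F) (_ : Measurable G) (_ : Measurable H)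
    (_ : ∀ x y, F x ^ (1 - t) * G y ^ t ≤ H ((1 - t) • x + t • y)),
    (∫⁻ x, F x) ^ (1 - t) * (∫⁻ x, G x) ^ t ≤ ∫⁻ x, H x := by
  intro n
  induction n with
  | zero =>
    intro F G H hF hG hH h
    simp only [lintegral_unique, volume_pi, Measure.pi_univ, Finset.univ_eq_empty,
      Finset.prod_empty, mul_one]
    convert! h default default
  | succ n ih =>
    intro F G H hF hG hH h
    have split : ∀ U : (Fin (n + 1) → ℝ) → ENNReal, Measurable U →
        ∫⁻ x, U x = ∫⁻ a, ∫⁻ z, U (Fin.cons a z) := by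
      intro U hU
      rw [← ((volume_preserving_piFinSuccAbove (fun _ : Fin (n + 1) => ℝ) 0).symm).lintegral_comp
        hU, Measure.volume_eq_prod, lintegral_prod _ (by fun_prop)]
      simp [MeasurableEquiv.piFinSuccAbove, Fin.consEquiv]
    have mcons : Measurable fun p : ℝ × (Fin n → ℝ) => (Fin.cons p.1 p.2 : Fin (n + 1) → ℝ) := by
      refine measurable_pi_iff.2 fun i => ?_
      refine Fin.cases ?_ (fun j => ?_) i
      · simpa using measurable_fst
      · simpa using! (measurable_pi_apply j).comp measurable_snd
    have mslice : ∀ a : ℝ, Measurable fun z : Fin n → ℝ => (Fin.cons a z : Fin (n + 1) → ℝ) :=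
      fun a => mcons.comp measurable_prodMk_left
    rw [split F hF, split G hG, split H hH]
    refine prekopaLeindler_real ht0 ht1 (hF.comp mcons).lintegral_prod_right'
      (hG.comp mcons).lintegral_prod_right' (hH.comp mcons).lintegral_prod_right' ?_
    intro a b
    refine ih (hF.comp (mslice a)) (hG.comp (mslice b)) (hH.comp (mslice _)) ?_
    intro x y
    convert! h (Fin.cons a x) (Fin.cons b y) using 2
    ext i
    refine Fin.cases ?_ (fun j => ?_) i <;> simp

/-- The Prékopa-Leindler inequality on Euclidean space. -/
theorem prekopaLeindler {n : ℕ} {t : ℝ} (ht0 : 0 < t) (ht1 : t < 1)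
    {F G H : EuclideanSpace ℝ (Fin n) → ENNReal} (hF : Measurable F) (hG : Measurable G)
    (hH : Measurable H) (h : ∀ x y, F x ^ (1 - t) * G y ^ t ≤ H ((1 - t) • x + t • y)) :
    (∫⁻ x, F x) ^ (1 - t) * (∫⁻ x, G x) ^ t ≤ ∫⁻ x, H x := by
  have e := EuclideanSpace.volume_preserving_symm_measurableEquiv_toLp (Fin n)
  have e' := e.symm
  rw [← e'.lintegral_comp hF, ← e'.lintegral_comp hG, ← e'.lintegral_comp hH]
  refine prekopaLeindler_pi ht0 ht1 n (hF.comp e'.measurable) (hG.comp e'.measurable)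
    (hH.comp e'.measurable) ?_
  intro x y
  exact h _ _

/-! ### First-order expansion in `t` -/

/-- Mean value theorem in the exponent. For `a = 0` both sides vanish and any `s` serves. -/
theorem exists_rpow_mul_exp_eq {a c t : ℝ} (ha : 0 ≤ a) (ht0 : 0 < t) (ht1 : t < 1) :
    ∃ s ∈ Set.Ioo 0 t, a ^ (1 - t) * Real.exp (-(t * c)) =
      a + t * (-(a ^ (1 - s) * Real.log a + c * a ^ (1 - s)) * Real.exp (-(s * c))) := by
  rcases ha.eq_or_lt with rfl | ha
  · refine ⟨t / 2, ⟨by linarith, by linarith⟩, ?_⟩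
    rw [Real.zero_rpow (by linarith), Real.zero_rpow (by linarith)]
    simp
  · have hd : ∀ s : ℝ, HasDerivAt (fun s : ℝ => a ^ (1 - s) * Real.exp (-(s * c)))
        (-(a ^ (1 - s) * Real.log a + c * a ^ (1 - s)) * Real.exp (-(s * c))) s := by
      intro s
      have h1 : HasDerivAt (fun s : ℝ => a ^ (1 - s)) (Real.log a * (-1) * a ^ (1 - s)) s :=
        ((hasDerivAt_id s).const_sub 1).const_rpow ha
      have h2 : HasDerivAt (fun s : ℝ => Real.exp (-(s * c)))
          (Real.exp (-(s * c)) * (-(1 * c))) s := ((hasDerivAt_id s).mul_const c).neg.exp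
      convert! h1.mul h2 using 1
      ring
    obtain ⟨s, hs, h⟩ := exists_hasDerivAt_eq_slope _ _ ht0
      (fun s _ => (hd s).continuousAt.continuousWithinAt) (fun s _ => hd s)
    refine ⟨s, hs, ?_⟩
    rw [h]
    simp only [sub_zero, Real.rpow_one, zero_mul, neg_zero, Real.exp_zero, mul_one]
    field_simp
    ring

/-- Borrowing half a power gives factors continuous up to `a = 0` when `s` is near `0`; this is
needed because a cut-off `F` has zeros. -/
theorem rpow_half_sub_mul_sqrt_log {a s : ℝ} (ha : 0 ≤ a) :
    a ^ (1 / 2 - s) * (2 * (√a * Real.log √a)) = a ^ (1 - s) * Real.log a := by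
  rcases ha.eq_or_lt with rfl | ha
  · simp
  · rw [Real.log_sqrt ha.le, Real.sqrt_eq_rpow, show (1 : ℝ) - s = (1 / 2 - s) + 1 / 2 by ring,
      Real.rpow_add ha]
    ring

theorem exists_eq_add_fderiv_segment {E : Type*} [NormedAddCommGroup E] [NormedSpace ℝ E]
    {F : E → ℝ} (hF : Differentiable ℝ F) (z v : E) {τ : ℝ} (hτ : 0 < τ) :
    ∃ θ ∈ Set.Ioo 0 τ, F (z + τ • v) = F z + τ * fderiv ℝ F (z + θ • v) v := by
  have hd : ∀ s : ℝ, HasDerivAt (fun s : ℝ => F (z + s • v)) (fderiv ℝ F (z + s • v) v) s := by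
    intro s
    have h1 : HasDerivAt (fun s : ℝ => z + s • v) v s := by
      simpa using ((hasDerivAt_id s).smul_const v).const_add z
    exact (hF (z + s • v)).hasFDerivAt.comp_hasDerivAt s h1
  obtain ⟨θ, hθ, h⟩ := exists_hasDerivAt_eq_slope _ _ hτ
    (fun s _ => (hd s).continuousAt.continuousWithinAt) (fun s _ => hd s)
  refine ⟨θ, hθ, ?_⟩
  rw [h]
  simp only [zero_smul, add_zero, sub_zero]
  field_simp
  ring

/-- First-order expansion in `t` of `F(x)^{1-t} e^{-tφ(y)}`, where `(1-t)x + ty = z`, uniformly for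
`z` and `y` in compact sets. -/
theorem eventually_rpow_mul_exp_le {E : Type*} [NormedAddCommGroup E] [NormedSpace ℝ E]
    {F φ : E → ℝ} (hF : ContDiff ℝ 1 F) (hF0 : ∀ z, 0 ≤ F z) (hφ : Continuous φ) {K B : Set E}
    (hK : IsCompact K) (hB : IsCompact B) {ε : ℝ} (hε : 0 < ε) :
    ∃ δ, 0 < δ ∧ δ < 1 ∧ ∀ t, 0 < t → t < δ → ∀ z ∈ K, ∀ y ∈ B,
      F (z + (t / (1 - t)) • (z - y)) ^ (1 - t) * Real.exp (-(t * φ y)) ≤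
        F z + t * (-(F z * Real.log (F z)) - φ y * F z + fderiv ℝ F z (z - y) + ε) := by
  -- Here `p = (s, θ, t)`, with `s` the mean value point in the exponent and `θ` the one on the
  -- segment, and `q = (z, y)`. `W p q` is the exact difference quotient and `W 0 q` the derivative;
  -- continuity at `p = 0` and compactness of `K ×ˢ B` make the error uniform.
  let W : (ℝ × ℝ × ℝ) → E × E → ℝ := fun p q =>
    -(F (q.1 + (p.2.2 / (1 - p.2.2)) • (q.1 - q.2)) ^ (1 / 2 - p.1) *
        (2 * (√(F (q.1 + (p.2.2 / (1 - p.2.2)) • (q.1 - q.2))) *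
          Real.log √(F (q.1 + (p.2.2 / (1 - p.2.2)) • (q.1 - q.2))))) +
        φ q.2 * F (q.1 + (p.2.2 / (1 - p.2.2)) • (q.1 - q.2)) ^ (1 - p.1)) *
      Real.exp (-(p.1 * φ q.2)) +
    (1 / (1 - p.2.2)) * fderiv ℝ F (q.1 + p.2.1 • (q.1 - q.2)) (q.1 - q.2)
  have hFc : Continuous F := hF.continuous
  have hF' : Continuous (fderiv ℝ F) := hF.continuous_fderiv one_ne_zero
  have hWc : ∀ q : E × E, ContinuousAt (fun r : (ℝ × ℝ × ℝ) × (E × E) => W r.1 r.2) (0, q) := by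
    intro q
    have c0 : ContinuousAt (fun r : (ℝ × ℝ × ℝ) × (E × E) => r.1.2.2 / (1 - r.1.2.2)) (0, q) :=
      ContinuousAt.div (by fun_prop) (by fun_prop) (by simp)
    have c1 : ContinuousAt (fun r : (ℝ × ℝ × ℝ) × (E × E) =>
        F (r.2.1 + (r.1.2.2 / (1 - r.1.2.2)) • (r.2.1 - r.2.2))) (0, q) :=
      ContinuousAt.comp' hFc.continuousAt
        ((by fun_prop : ContinuousAt (fun r : (ℝ × ℝ × ℝ) × (E × E) => r.2.1) (0, q)).add
          (c0.smul (by fun_prop)))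
    have c2 : ContinuousAt (fun r : (ℝ × ℝ × ℝ) × (E × E) =>
        F (r.2.1 + (r.1.2.2 / (1 - r.1.2.2)) • (r.2.1 - r.2.2)) ^ (1 / 2 - r.1.1)) (0, q) :=
      c1.rpow (by fun_prop) (Or.inr (by norm_num))
    have c3 : ContinuousAt (fun r : (ℝ × ℝ × ℝ) × (E × E) =>
        F (r.2.1 + (r.1.2.2 / (1 - r.1.2.2)) • (r.2.1 - r.2.2)) ^ (1 - r.1.1)) (0, q) :=
      c1.rpow (by fun_prop) (Or.inr (by norm_num))
    have c4 := ContinuousAt.comp' (Real.continuous_mul_log.continuousAt) c1.sqrt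
    have c5 : ContinuousAt (fun r : (ℝ × ℝ × ℝ) × (E × E) => 1 / (1 - r.1.2.2)) (0, q) :=
      ContinuousAt.div (by fun_prop) (by fun_prop) (by simp)
    have c6 : ContinuousAt (fun r : (ℝ × ℝ × ℝ) × (E × E) =>
      fderiv ℝ F (r.2.1 + r.1.2.1 • (r.2.1 - r.2.2)) (r.2.1 - r.2.2)) (0, q) := by
      refine Continuous.continuousAt ?_
      exact (hF'.comp' (by fun_prop)).clm_apply (by fun_prop)
    have c7 : Continuous (fun r : (ℝ × ℝ × ℝ) × (E × E) => φ r.2.2) := hφ.comp' (by fun_prop)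
    have c8 : Continuous (fun r : (ℝ × ℝ × ℝ) × (E × E) => Real.exp (-(r.1.1 * φ r.2.2))) := by
      fun_prop
    exact ((((c2.mul (c4.const_mul 2)).add (c7.continuousAt.mul c3)).neg.mul c8.continuousAt).add
      (c5.mul c6))
  have hW0 : ∀ q : E × E, W 0 q =
      -(F q.1 * Real.log (F q.1)) - φ q.2 * F q.1 + fderiv ℝ F q.1 (q.1 - q.2) := by
    intro q
    have := rpow_half_sub_mul_sqrt_log (hF0 q.1) (s := 0)
    simp only [sub_zero, Real.rpow_one] at this
    simp only [W, Prod.fst_zero, Prod.snd_zero, zero_div, zero_smul, add_zero, sub_zero, this]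
    simp
    ring
  have hev : ∀ᶠ p : ℝ × ℝ × ℝ in 𝓝 0, ∀ q ∈ K ×ˢ B, W p q - W 0 q < ε := by
    refine (hK.prod hB).eventually_forall_of_forall_eventually fun q _ => ?_
    have h0 : ContinuousAt (fun r : (ℝ × ℝ × ℝ) × (E × E) => W 0 r.2) (0, q) :=
      ContinuousAt.comp (g := fun r : (ℝ × ℝ × ℝ) × (E × E) => W r.1 r.2)
        (f := fun r : (ℝ × ℝ × ℝ) × (E × E) => ((0 : ℝ × ℝ × ℝ), r.2)) (hWc q) (by fun_prop)
    refine ((hWc q).sub h0).eventually_lt continuousAt_const ?_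
    simpa using hε
  obtain ⟨δ, hδ, hball⟩ := Metric.eventually_nhds_iff.1 hev
  -- These bounds force `t / (1 - t) < δ`, hence `θ < δ`.
  refine ⟨min (δ / 2) (1 / 4), by positivity, (min_le_right _ _).trans_lt (by norm_num), ?_⟩
  intro t ht0 ht z hz y hy
  have ht1 : t < 1 / 4 := ht.trans_le (min_le_right _ _)
  have htδ : t < δ / 2 := ht.trans_le (min_le_left _ _)
  have h1t : 0 < 1 - t := by linarith
  have hτ : 0 < t / (1 - t) := by positivity
  have hτδ : t / (1 - t) < δ := by
    rw [div_lt_iff₀ h1t]; nlinarith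
  obtain ⟨s, hs, e1⟩ := exists_rpow_mul_exp_eq (c := φ y)
    (hF0 (z + (t / (1 - t)) • (z - y))) ht0 (by linarith)
  obtain ⟨θ, hθ, e2⟩ := exists_eq_add_fderiv_segment (hF.differentiable one_ne_zero) z (z - y) hτ
  have hd : dist ((s, θ, t) : ℝ × ℝ × ℝ) 0 < δ := by
    simp only [Prod.dist_eq, Prod.fst_zero, Prod.snd_zero, Real.dist_eq, sub_zero,
      abs_of_pos hs.1, abs_of_pos hθ.1, abs_of_pos ht0, max_lt_iff]
    exact ⟨by linarith [hs.2], by linarith [hθ.2], by linarith⟩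
  have key := hball hd (z, y) ⟨hz, hy⟩
  rw [hW0] at key
  simp only [W] at key
  rw [rpow_half_sub_mul_sqrt_log (hF0 _)] at key
  rw [e1]
  nth_rewrite 1 [e2]
  have e3 : t / (1 - t) * fderiv ℝ F (z + θ • (z - y)) (z - y) =
      t * (1 / (1 - t) * fderiv ℝ F (z + θ • (z - y)) (z - y)) := by ring
  rw [e3]
  have := mul_le_mul_of_nonneg_left key.le ht0.le
  linarith

/-- Prékopa-Leindler with `H = F + t(P + ε)` on the ball `K` of radius `R + R'`, compared to first
order in `t`. Outside `K` the first factor vanishes: if `y ∈ B` and `‖z‖ > R + R'`, then `x = z +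
(t/(1-t))(z - y)` has norm above `R`. -/
theorem mul_log_sub_log_le_integral {n : ℕ} {F φ P : EuclideanSpace ℝ (Fin n) → ℝ} {R R' : ℝ}
    (hF : ContDiff ℝ 1 F) (hF0 : ∀ z, 0 ≤ F z) (hFR : ∀ z, R < ‖z‖ → F z = 0)
    (hφ : Continuous φ) (hPm : Measurable P) (hPi : Integrable P) (hR : 0 ≤ R) (hR' : 0 ≤ R')
    (hP : ∀ z, ∀ y ∈ Metric.closedBall (0 : EuclideanSpace ℝ (Fin n)) R',
      -(F z * Real.log (F z)) - φ y * F z + fderiv ℝ F z (z - y) ≤ P z)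
    (hFpos : 0 < ∫ z, F z)
    (hGpos : 0 < ∫ y in Metric.closedBall (0 : EuclideanSpace ℝ (Fin n)) R', Real.exp (-φ y)) :
    (∫ z, F z) * (Real.log (∫ y in Metric.closedBall (0 : EuclideanSpace ℝ (Fin n)) R',
      Real.exp (-φ y)) - Real.log (∫ z, F z)) ≤ ∫ z, P z := by
  set B := Metric.closedBall (0 : EuclideanSpace ℝ (Fin n)) R' with hBdef
  set K := Metric.closedBall (0 : EuclideanSpace ℝ (Fin n)) (R + R') with hKdef
  have hK : IsCompact K := isCompact_closedBall _ _
  have hB : IsCompact B := isCompact_closedBall _ _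
  set ZF := ∫ z, F z
  set ZG := ∫ y in B, Real.exp (-φ y)
  have hFc : Continuous F := hF.continuous
  have hFi : Integrable F := hFc.integrable_of_hasCompactSupport
    (HasCompactSupport.of_support_subset_isCompact
      (isCompact_closedBall (0 : EuclideanSpace ℝ (Fin n)) R) (fun z hz => by
        by_contra h
        exact hz (hFR z (by simpa using h))))
  have hGi : IntegrableOn (fun y => Real.exp (-φ y)) B :=
    (by fun_prop : Continuous fun y => Real.exp (-φ y)).continuousOn.integrableOn_compact hB
  have hFK : ∀ t : ℝ, 0 < t → t < 1 → ∀ z ∉ K, ∀ y ∈ B, F (z + (t / (1 - t)) • (z - y)) = 0 := by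
    intro t ht0 ht1 z hz y hy
    refine hFR _ ?_
    simp only [hKdef, hBdef, mem_closedBall_zero_iff, not_le] at hz hy
    have hτ : 0 < t / (1 - t) := div_pos ht0 (by linarith)
    have h1 : z + (t / (1 - t)) • (z - y) = (1 + t / (1 - t)) • z - (t / (1 - t)) • y := by
      module
    rw [h1]
    refine lt_of_lt_of_le ?_ (norm_sub_norm_le _ _)
    rw [norm_smul, norm_smul, Real.norm_of_nonneg (by positivity), Real.norm_of_nonneg hτ.le]
    have h2 : (t / (1 - t)) * ‖y‖ ≤ (t / (1 - t)) * R' := by gcongr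
    have h3 : (t / (1 - t)) * R' ≤ (t / (1 - t)) * ‖z‖ := by gcongr; linarith
    linarith
  -- Outside `K` both `F` and its derivative vanish, so the hypothesis on `P` at `y = 0` gives `P ≥
  -- 0` there.
  have hPK : ∫ z in K, P z ≤ ∫ z, P z := by
    have hind : ∫ z, K.indicator P z ≤ ∫ z, P z := by
      refine integral_mono (hPi.indicator hK.measurableSet) hPi fun z => ?_
      by_cases hz : z ∈ K
      · simp [hz]
      · have h0 : ∀ᶠ w in 𝓝 z, F w = 0 := by
          have : ∀ᶠ w in 𝓝 z, R < ‖w‖ := by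
            refine (continuous_norm.tendsto z).eventually (lt_mem_nhds ?_)
            simp only [hKdef, mem_closedBall_zero_iff, not_le] at hz
            linarith
          exact this.mono fun w hw => hFR w hw
        have h1 : fderiv ℝ F z = 0 := by
          rw [Filter.EventuallyEq.fderiv_eq (show F =ᶠ[𝓝 z] fun _ => 0 from h0)]
          simp
        have := hP z 0 (by simpa [hBdef] using hR')
        simpa [hz, h0.self_of_nhds, h1] using this
    rwa [integral_indicator hK.measurableSet] at hind
  have hV : 0 ≤ volume.real K := measureReal_nonneg
  refine le_of_forall_pos_le_add fun η hη => ?_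
  -- The `+ 1` keeps the denominator positive even when `K` is null.
  set ε := η / (volume.real K + 1) with hε_def
  have hε : 0 < ε := by positivity
  have hεV : ε * volume.real K ≤ η := by
    rw [hε_def, div_mul_eq_mul_div, div_le_iff₀ (by positivity)]
    nlinarith
  obtain ⟨δ, hδ0, hδ1, hδ⟩ := eventually_rpow_mul_exp_le hF hF0 hφ hK hB hε
  set t := δ / 2
  have ht0 : 0 < t := by positivity
  have htδ : t < δ := by simp only [t]; linarith
  have ht1 : t < 1 := by linarith
  have h1t : 0 < 1 - t := by linarith
  have hle : ∀ z ∈ K, ∀ y ∈ B, F (z + (t / (1 - t)) • (z - y)) ^ (1 - t) * Real.exp (-(t * φ y)) ≤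
      F z + t * (P z + ε) := by
    intro z hz y hy
    refine (hδ t ht0 htδ z hz y hy).trans ?_
    gcongr
    exact hP z y hy
  have hnonneg : ∀ z ∈ K, 0 ≤ F z + t * (P z + ε) := fun z hz =>
    le_trans (mul_nonneg (Real.rpow_nonneg (hF0 _) _) (Real.exp_nonneg _))
      (hle z hz 0 (by simpa [hBdef] using hR'))
  have PL := prekopaLeindler ht0 ht1 (F := fun z => ENNReal.ofReal (F z))
    (G := B.indicator fun y => ENNReal.ofReal (Real.exp (-φ y)))
    (H := K.indicator fun z => ENNReal.ofReal (F z + t * (P z + ε)))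
    hFc.measurable.ennreal_ofReal
    ((by fun_prop : Continuous fun y => Real.exp (-φ y)).measurable.ennreal_ofReal.indicator
      hB.measurableSet)
    (Measurable.indicator (by fun_prop) hK.measurableSet) ?_
  · have hint : IntegrableOn (fun z => F z + t * (P z + ε)) K := by
      refine hFi.integrableOn.add ((hPi.integrableOn.add ?_).const_mul t)
      exact integrableOn_const hK.measure_lt_top.ne
    rw [lintegral_indicator hB.measurableSet, lintegral_indicator hK.measurableSet,
      ← ofReal_integral_eq_lintegral_ofReal hFi (ae_of_all _ hF0),
      ← ofReal_integral_eq_lintegral_ofReal hGi (ae_of_all _ fun y => Real.exp_nonneg _),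
      ← ofReal_integral_eq_lintegral_ofReal hint
        ((ae_restrict_iff' hK.measurableSet).2 (ae_of_all _ hnonneg)),
      ENNReal.ofReal_rpow_of_pos hFpos, ENNReal.ofReal_rpow_of_pos hGpos,
      ← ENNReal.ofReal_mul (by positivity),
      ENNReal.ofReal_le_ofReal_iff (setIntegral_nonneg hK.measurableSet hnonneg)] at PL
    have hsum : ∫ z in K, (F z + t * (P z + ε)) ≤ ZF + t * ((∫ z, P z) + η) := by
      have hεi : IntegrableOn (fun _ : EuclideanSpace ℝ (Fin n) => ε) K :=
        integrableOn_const hK.measure_lt_top.ne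
      have hPε : IntegrableOn (fun z => P z + ε) K := hPi.integrableOn.add hεi
      rw [integral_add hFi.integrableOn (hPε.const_mul t),
        integral_const_mul, integral_add hPi.integrableOn hεi, setIntegral_const, smul_eq_mul]
      have h1 : ∫ z in K, F z ≤ ZF := setIntegral_le_integral hFi (ae_of_all _ hF0)
      have h2 : (∫ z in K, P z) + volume.real K * ε ≤ (∫ z, P z) + η := by linarith
      have h3 := mul_le_mul_of_nonneg_left h2 ht0.le
      linarith
    -- By `1 + u ≤ e^u` this lower bound holds for every `t`, so one small `t` suffices and no limit
    -- is taken.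
    have hexp : ZF * (1 + t * (Real.log ZG - Real.log ZF)) ≤ ZF ^ (1 - t) * ZG ^ t := by
      have e : ZF ^ (1 - t) * ZG ^ t = ZF * Real.exp (t * (Real.log ZG - Real.log ZF)) := by
        have e' : ZF = Real.exp (Real.log ZF) := (Real.exp_log hFpos).symm
        rw [Real.rpow_def_of_pos hFpos, Real.rpow_def_of_pos hGpos, ← Real.exp_add,
          show Real.log ZF * (1 - t) + Real.log ZG * t =
            Real.log ZF + t * (Real.log ZG - Real.log ZF) by ring, Real.exp_add, ← e']
      rw [e]
      gcongr
      linarith [Real.add_one_le_exp (t * (Real.log ZG - Real.log ZF))]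
    have hfin : t * (ZF * (Real.log ZG - Real.log ZF)) ≤ t * ((∫ z, P z) + η) := by
      have := hexp.trans (PL.trans hsum)
      linarith
    exact le_of_mul_le_mul_left hfin ht0
  · intro x y
    by_cases hy : y ∈ B
    · have hx : ((1 - t) • x + t • y) + (t / (1 - t)) • (((1 - t) • x + t • y) - y) = x := by
        have e : ((1 - t) • x + t • y) - y = (1 - t) • (x - y) := by module
        rw [e, smul_smul, div_mul_cancel₀ _ h1t.ne']
        module
      by_cases hz : (1 - t) • x + t • y ∈ K
      · simp only [hy, hz, Set.indicator_of_mem]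
        rw [ENNReal.ofReal_rpow_of_nonneg (hF0 x) h1t.le,
          ENNReal.ofReal_rpow_of_pos (Real.exp_pos _),
          ← ENNReal.ofReal_mul (Real.rpow_nonneg (hF0 _) _)]
        refine ENNReal.ofReal_le_ofReal ?_
        have := hle _ hz y hy
        rw [hx] at this
        refine le_trans (le_of_eq ?_) this
        rw [← Real.exp_mul]
        congr 2
        ring
      · have := hFK t ht0 ht1 _ hz y hy
        rw [hx] at this
        simp [this, h1t]
    · simp [hy, ht0]

/-! ### The Legendre transform -/

theorem inner_sub_le_legendreTransform {n : ℕ} {φ : EuclideanSpace ℝ (Fin n) → ℝ}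
    (hc : Continuous φ) (hφ : IsSuperlinear φ) (x z : EuclideanSpace ℝ (Fin n)) :
    inner ℝ x z - φ z ≤ legendreTransform φ x :=
  le_ciSup (bddAbove_range_legendre hc hφ x) z

theorem measurable_legendreTransform {n : ℕ} {φ : EuclideanSpace ℝ (Fin n) → ℝ}
    (hc : Continuous φ) (hφ : IsSuperlinear φ) : Measurable (legendreTransform φ) :=
  (lowerSemicontinuous_ciSup (bddAbove_range_legendre hc hφ) fun z =>
    (by fun_prop : Continuous fun x : EuclideanSpace ℝ (Fin n) =>
      inner ℝ x z - φ z).lowerSemicontinuous).measurable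

theorem ConvexOn.add_fderiv_sub_le {E : Type*} [NormedAddCommGroup E] [NormedSpace ℝ E]
    {φ : E → ℝ} (hφ : ConvexOn ℝ Set.univ φ) (hd : Differentiable ℝ φ) (x z : E) :
    φ x + fderiv ℝ φ x (z - x) ≤ φ z := by
  have h1 : HasDerivAt (fun s : ℝ => x + s • (z - x)) (z - x) 0 := by
    simpa using ((hasDerivAt_id (0 : ℝ)).smul_const (z - x)).const_add x
  have h2 : HasDerivAt (fun s : ℝ => φ (x + s • (z - x))) (fderiv ℝ φ x (z - x)) 0 := by
    refine HasFDerivAt.comp_hasDerivAt (0 : ℝ) ?_ h1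
    simpa using (hd x).hasFDerivAt
  have h3 : ConvexOn ℝ Set.univ fun s : ℝ => φ (x + s • (z - x)) := by
    have := hφ.comp_affineMap (AffineMap.lineMap (k := ℝ) x z)
    simpa [Function.comp_def, AffineMap.lineMap_apply, add_comm] using this
  have h4 := h3.le_slope_of_hasDerivAt (Set.mem_univ 0) (Set.mem_univ 1) one_pos h2
  simp only [slope, sub_zero, inv_one, one_smul, zero_smul, add_zero, vsub_eq_sub] at h4
  rw [add_sub_cancel] at h4
  linarith

/-- Equality case of Fenchel-Young: by the tangent inequality the supremum is attained at `z = x`.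
-/
theorem legendreTransform_gradient {n : ℕ} {φ : EuclideanSpace ℝ (Fin n) → ℝ}
    (hφ : ConvexOn ℝ Set.univ φ) (hd : Differentiable ℝ φ) (hs : IsSuperlinear φ)
    (x : EuclideanSpace ℝ (Fin n)) :
    legendreTransform φ (∇ φ x) = inner ℝ x (∇ φ x) - φ x := by
  refine le_antisymm (ciSup_le fun z => ?_) ?_
  · have := hφ.add_fderiv_sub_le hd x z
    rw [← inner_gradient_left, inner_sub_right] at this
    linarith [real_inner_comm (∇ φ x) x]
  · rw [real_inner_comm]
    exact inner_sub_le_legendreTransform hd.continuous hs _ _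

/-! ### Cutting off, and removing the cutoff -/

/-- The inequality between an integral and the entropy, truncated by a cutoff function at scale
`R` and by the ball of radius `R'`. -/
theorem mul_log_sub_log_le_integral_cutoff {n : ℕ} {φ f : EuclideanSpace ℝ (Fin n) → ℝ}
    (hφ : Continuous φ) (hs : IsSuperlinear φ) (hf : ContDiff ℝ 1 f)
    (χ : ContDiffBump (0 : EuclideanSpace ℝ (Fin n))) {R R' : ℝ} (hR : 0 < R) (hR' : 0 ≤ R')
    (hGpos : 0 < ∫ y in Metric.closedBall (0 : EuclideanSpace ℝ (Fin n)) R', Real.exp (-φ y))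
    (hPi : Integrable fun z => χ (R⁻¹ • z) * ((f z - inner ℝ z (∇ f z) +
        legendreTransform φ (∇ f z)) * Real.exp (-f z)) +
      Real.exp (-f z) * (Real.negMulLog (χ (R⁻¹ • z)) +
        R⁻¹ * ‖fderiv ℝ χ (R⁻¹ • z)‖ * (‖z‖ + R'))) :
    (∫ z, χ (R⁻¹ • z) * Real.exp (-f z)) *
      (Real.log (∫ y in Metric.closedBall (0 : EuclideanSpace ℝ (Fin n)) R', Real.exp (-φ y)) -
        Real.log (∫ z, χ (R⁻¹ • z) * Real.exp (-f z))) ≤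
      ∫ z, (χ (R⁻¹ • z) * ((f z - inner ℝ z (∇ f z) +
        legendreTransform φ (∇ f z)) * Real.exp (-f z)) +
      Real.exp (-f z) * (Real.negMulLog (χ (R⁻¹ • z)) +
        R⁻¹ * ‖fderiv ℝ χ (R⁻¹ • z)‖ * (‖z‖ + R'))) := by
  have hχ : ContDiff ℝ 1 χ := χ.contDiff (n := 1)
  have hχR : ContDiff ℝ 1 fun z : EuclideanSpace ℝ (Fin n) => χ (R⁻¹ • z) :=
    hχ.comp (contDiff_const_smul _)
  have hF : ContDiff ℝ 1 fun z => χ (R⁻¹ • z) * Real.exp (-f z) := hχR.mul hf.neg.exp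
  have hF0 : ∀ z, 0 ≤ χ (R⁻¹ • z) * Real.exp (-f z) := fun z =>
    mul_nonneg χ.nonneg (Real.exp_nonneg _)
  have hsupp : ∀ z : EuclideanSpace ℝ (Fin n), R * χ.rOut < ‖z‖ →
      χ (R⁻¹ • z) * Real.exp (-f z) = 0 := by
    intro z hz
    rw [χ.zero_of_le_dist, zero_mul]
    rw [dist_zero_right, norm_smul, Real.norm_of_nonneg (by positivity), inv_mul_eq_div,
      le_div_iff₀ hR]
    linarith
  have hφ_meas := measurable_legendreTransform hφ hs
  have hgrad : Continuous fun z => ∇ f z :=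
    (InnerProductSpace.toDual ℝ _).symm.continuous.comp (hf.continuous_fderiv one_ne_zero)
  have hfc := hf.continuous
  refine mul_log_sub_log_le_integral hF hF0 hsupp hφ ?_ hPi (by have := χ.rOut_pos; positivity)
    hR' ?_ ?_ hGpos
  · have h1 := hφ_meas.comp hgrad.measurable
    have h2 : Continuous fun z => fderiv ℝ χ (R⁻¹ • z) :=
      (hχ.continuous_fderiv one_ne_zero).comp (continuous_const_smul _)
    have h3 := hχR.continuous
    have h4 : Continuous fun z => Real.exp (-f z) * (Real.negMulLog (χ (R⁻¹ • z)) +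
        R⁻¹ * ‖fderiv ℝ χ (R⁻¹ • z)‖ * (‖z‖ + R')) := by fun_prop
    have h5 : Continuous fun z => f z - inner ℝ z (∇ f z) := by fun_prop
    exact (h3.measurable.mul ((h5.measurable.add h1).mul
      (by fun_prop : Continuous fun z => Real.exp (-f z)).measurable)).add h4.measurable
  · intro z y hy
    rw [mem_closedBall_zero_iff] at hy
    have hd1 : HasFDerivAt (fun z => χ (R⁻¹ • z)) (R⁻¹ • fderiv ℝ χ (R⁻¹ • z)) z := by
      have h1 : HasFDerivAt (fun z : EuclideanSpace ℝ (Fin n) => R⁻¹ • z)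
        (R⁻¹ • ContinuousLinearMap.id ℝ _) z := (hasFDerivAt_id z).const_smul R⁻¹
      have := ((hχ.differentiable one_ne_zero) (R⁻¹ • z)).hasFDerivAt.comp z h1
      convert! this using 1
      ext v
      simp
    have hd2 : HasFDerivAt (fun z => Real.exp (-f z)) (Real.exp (-f z) • -fderiv ℝ f z) z :=
      ((hf.differentiable one_ne_zero) z).hasFDerivAt.neg.exp
    rw [(hd1.fun_mul hd2).fderiv]
    -- The cutoff contributes two errors: `-χ log χ` from the logarithm, and its gradient term from
    -- the product rule.
    have hlog : -(χ (R⁻¹ • z) * Real.exp (-f z) * Real.log (χ (R⁻¹ • z) * Real.exp (-f z))) =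
        Real.exp (-f z) * Real.negMulLog (χ (R⁻¹ • z)) +
          χ (R⁻¹ • z) * (Real.exp (-f z) * f z) := by
      have := Real.negMulLog_mul (χ (R⁻¹ • z)) (Real.exp (-f z))
      simp only [Real.negMulLog, Real.log_exp] at this ⊢
      linarith
    rw [hlog]
    -- Fenchel-Young removes the dependence on `y` and produces `φ*(∇f)`.
    have hY := inner_sub_le_legendreTransform hφ hs (∇ f z) y
    have hχ' : R⁻¹ * fderiv ℝ χ (R⁻¹ • z) (z - y) ≤
        R⁻¹ * ‖fderiv ℝ χ (R⁻¹ • z)‖ * (‖z‖ + R') := by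
      rw [mul_assoc]
      have h1 : fderiv ℝ χ (R⁻¹ • z) (z - y) ≤ ‖fderiv ℝ χ (R⁻¹ • z)‖ * ‖z - y‖ :=
        (le_abs_self _).trans ((fderiv ℝ χ (R⁻¹ • z)).le_opNorm _)
      have h2 : ‖z - y‖ ≤ ‖z‖ + R' := (norm_sub_le _ _).trans (by linarith)
      gcongr
      exact h1.trans (by gcongr)
    have hA := mul_le_mul_of_nonneg_left hY (hF0 z)
    have hB := mul_le_mul_of_nonneg_left hχ' (Real.exp_nonneg (-f z))
    have hi : inner ℝ z (∇ f z) = fderiv ℝ f z z := by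
      rw [real_inner_comm, inner_gradient_left]
    rw [inner_gradient_left] at hA
    simp only [add_apply, smul_apply, neg_apply, smul_eq_mul, hi]
    rw [map_sub (fderiv ℝ f z)]
    linarith
  · refine hF.continuous.integral_pos_of_hasCompactSupport_nonneg_nonzero (x := 0) ?_ hF0 ?_
    · refine HasCompactSupport.of_support_subset_isCompact
        (isCompact_closedBall (0 : EuclideanSpace ℝ (Fin n)) (R * χ.rOut)) fun z hz => ?_
      by_contra h
      exact hz (hsupp z (by simpa using h))
    · simp only [smul_zero]
      rw [χ.one_of_mem_closedBall (by simp [χ.rIn_pos.le])]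
      simp [Real.exp_ne_zero]

/-- The entropy inequality with respect to Lebesgue measure. -/
theorem neg_integral_mul_log_integral_le {n : ℕ} {φ f : EuclideanSpace ℝ (Fin n) → ℝ}
    (hφ : Continuous φ) (hs : IsSuperlinear φ) (hprob : ∫ x, Real.exp (-φ x) = 1)
    (hf : ContDiff ℝ 1 f) (hfi : Integrable fun z => Real.exp (-f z))
    (hDi : Integrable fun z => (f z - inner ℝ z (∇ f z) + legendreTransform φ (∇ f z)) *
      Real.exp (-f z)) :
    -((∫ z, Real.exp (-f z)) * Real.log (∫ z, Real.exp (-f z))) ≤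
      ∫ z, (f z - inner ℝ z (∇ f z) + legendreTransform φ (∇ f z)) * Real.exp (-f z) := by
  -- A non-integrable function has integral `0` by convention, so total mass `1` forces
  -- integrability.
  have hφi : Integrable fun x => Real.exp (-φ x) := by
    by_contra h
    rw [integral_undef h] at hprob
    exact zero_ne_one hprob
  set Z := ∫ z, Real.exp (-f z)
  have hZ : 0 < Z := integral_exp_pos hfi
  have hGlim : Tendsto (fun k : ℕ => ∫ y in Metric.closedBall (0 : EuclideanSpace ℝ (Fin n)) k,
      Real.exp (-φ y)) atTop (𝓝 1) := by
    have := tendsto_setIntegral_of_monotone (μ := volume) (f := fun y => Real.exp (-φ y))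
      (s := fun k : ℕ => Metric.closedBall (0 : EuclideanSpace ℝ (Fin n)) k)
      (fun k => Metric.isClosed_closedBall.measurableSet)
      (fun i j hij => Metric.closedBall_subset_closedBall (by exact_mod_cast hij))
      (by rw [Metric.iUnion_closedBall_nat]; exact hφi.integrableOn)
    rwa [Metric.iUnion_closedBall_nat, setIntegral_univ, hprob] at this
  let χ : ContDiffBump (0 : EuclideanSpace ℝ (Fin n)) := ⟨1, 2, one_pos, one_lt_two⟩
  have hχ : ContDiff ℝ 1 χ := χ.contDiff (n := 1)
  obtain ⟨C, hC⟩ := (hχ.continuous_fderiv one_ne_zero).bounded_above_of_compact_support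
    (χ.hasCompactSupport.fderiv ℝ)
  have hC0 : 0 ≤ C := (norm_nonneg _).trans (hC 0)
  have hev : ∀ z : EuclideanSpace ℝ (Fin n), ∀ᶠ k : ℕ in atTop,
      ‖((k : ℝ) + 1)⁻¹ • z‖ < 1 := by
    intro z
    filter_upwards [eventually_ge_atTop ⌈‖z‖⌉₊] with k hk
    have h1 : ‖z‖ ≤ k := (Nat.le_ceil _).trans (by exact_mod_cast hk)
    rw [norm_smul, Real.norm_of_nonneg (by positivity), inv_mul_eq_div,
      div_lt_one (by positivity)]
    linarith
  have hχ1 : ∀ w : EuclideanSpace ℝ (Fin n), ‖w‖ < 1 → χ w = 1 := fun w hw =>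
    χ.one_of_mem_closedBall (by simpa using hw.le)
  have hdχ1 : ∀ w : EuclideanSpace ℝ (Fin n), ‖w‖ < 1 → fderiv ℝ χ w = 0 := by
    intro w hw
    have : χ =ᶠ[𝓝 w] 1 := χ.eventuallyEq_one_of_mem_ball (by simpa using hw)
    rw [this.fderiv_eq]
    exact fderiv_const_apply 1
  have hdχ2 : ∀ w : EuclideanSpace ℝ (Fin n), 2 < ‖w‖ → fderiv ℝ χ w = 0 := by
    intro w hw
    have h0 : ∀ᶠ v in 𝓝 w, χ v = 0 := by
      filter_upwards [(continuous_norm.tendsto w).eventually (lt_mem_nhds hw)] with v hv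
      exact χ.zero_of_le_dist (by simpa using hv.le)
    rw [Filter.EventuallyEq.fderiv_eq (show χ =ᶠ[𝓝 w] fun _ => 0 from h0)]
    simp
  have hχmeas : ∀ R : ℝ, Continuous fun z : EuclideanSpace ℝ (Fin n) => χ (R • z) := fun R =>
    hχ.continuous.comp (continuous_const_smul R)
  have hdχmeas : ∀ R : ℝ, Continuous fun z : EuclideanSpace ℝ (Fin n) => fderiv ℝ χ (R • z) :=
    fun R => (hχ.continuous_fderiv one_ne_zero).comp (continuous_const_smul R)
  have hfc := hf.continuous
  have hFlim : Tendsto (fun k : ℕ => ∫ z, χ (((k : ℝ) + 1)⁻¹ • z) * Real.exp (-f z)) atTop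
      (𝓝 Z) := by
    refine tendsto_integral_of_dominated_convergence (fun z => Real.exp (-f z)) (fun k => ?_) hfi
      (fun k => ae_of_all _ fun z => ?_) (ae_of_all _ fun z => ?_)
    · have := hχmeas ((k : ℝ) + 1)⁻¹
      exact Continuous.aestronglyMeasurable (by fun_prop)
    · rw [norm_mul, Real.norm_of_nonneg χ.nonneg, Real.norm_of_nonneg (Real.exp_nonneg _)]
      exact mul_le_of_le_one_left (Real.exp_nonneg _) χ.le_one
    · refine tendsto_const_nhds.congr' ?_
      filter_upwards [hev z] with k hk
      rw [hχ1 _ hk, one_mul]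
  set D := fun z => (f z - inner ℝ z (∇ f z) + legendreTransform φ (∇ f z)) * Real.exp (-f z)
    with hD
  let P : ℝ → ℕ → EuclideanSpace ℝ (Fin n) → ℝ := fun R' k z =>
    χ (((k : ℝ) + 1)⁻¹ • z) * D z +
      Real.exp (-f z) * (Real.negMulLog (χ (((k : ℝ) + 1)⁻¹ • z)) +
        ((k : ℝ) + 1)⁻¹ * ‖fderiv ℝ χ (((k : ℝ) + 1)⁻¹ • z)‖ * (‖z‖ + R'))
  have hPmeas : ∀ R' k, AEStronglyMeasurable (P R' k) := by
    intro R' k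
    have h1 := hχmeas ((k : ℝ) + 1)⁻¹
    have h2 := hdχmeas ((k : ℝ) + 1)⁻¹
    exact (h1.aestronglyMeasurable.mul hDi.aestronglyMeasurable).add
      (Continuous.aestronglyMeasurable (by fun_prop))
  -- A bound independent of `k`: `-χ log χ ≤ 1`, and the rescaled gradient of `χ` vanishes where
  -- `‖z‖ > 2(k + 1)`, so the growth of `‖z‖ + R'` is absorbed by the factor `1/(k + 1)`.
  have hPbound : ∀ R', 0 ≤ R' → ∀ k z,
      ‖P R' k z‖ ≤ ‖D z‖ + Real.exp (-f z) * (1 + C * (2 + R')) := by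
    intro R' hR' k z
    have hk : (0 : ℝ) < (k : ℝ) + 1 := by positivity
    have hk1 : ((k : ℝ) + 1)⁻¹ ≤ 1 := inv_le_one_of_one_le₀ (by simp)
    have hχ0 : 0 ≤ χ (((k : ℝ) + 1)⁻¹ • z) := χ.nonneg
    have hn0 := Real.negMulLog_nonneg hχ0 χ.le_one
    have hn1 := Real.negMulLog_le_one_sub_self hχ0
    have hd : ((k : ℝ) + 1)⁻¹ * ‖fderiv ℝ χ (((k : ℝ) + 1)⁻¹ • z)‖ * (‖z‖ + R') ≤
        C * (2 + R') := by
      rcases lt_or_ge 2 ‖((k : ℝ) + 1)⁻¹ • z‖ with h | h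
      · rw [hdχ2 _ h]
        simp only [norm_zero, mul_zero, zero_mul]
        positivity
      · rw [norm_smul, Real.norm_of_nonneg (by positivity)] at h
        have h1 : ((k : ℝ) + 1)⁻¹ * (‖z‖ + R') ≤ 2 + R' := by nlinarith
        calc ((k : ℝ) + 1)⁻¹ * ‖fderiv ℝ χ (((k : ℝ) + 1)⁻¹ • z)‖ * (‖z‖ + R') =
              ‖fderiv ℝ χ (((k : ℝ) + 1)⁻¹ • z)‖ * (((k : ℝ) + 1)⁻¹ * (‖z‖ + R')) := by ring
          _ ≤ C * (2 + R') := mul_le_mul (hC _) h1 (by positivity) hC0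
    refine (norm_add_le _ _).trans (add_le_add ?_ ?_)
    · rw [norm_mul, Real.norm_of_nonneg hχ0]
      exact mul_le_of_le_one_left (norm_nonneg _) χ.le_one
    · rw [Real.norm_of_nonneg (by positivity)]
      gcongr
      linarith
  have hbi : ∀ R', Integrable fun z => ‖D z‖ + Real.exp (-f z) * (1 + C * (2 + R')) :=
    fun R' => hDi.norm.add (hfi.mul_const _)
  have hPlim : ∀ R', 0 ≤ R' → Tendsto (fun k => ∫ z, P R' k z) atTop (𝓝 (∫ z, D z)) := by
    intro R' hR'
    refine tendsto_integral_of_dominated_convergence _ (hPmeas R') (hbi R')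
      (fun k => ae_of_all _ (hPbound R' hR' k)) (ae_of_all _ fun z => ?_)
    refine tendsto_const_nhds.congr' ?_
    filter_upwards [hev z] with k hk
    simp [P, hχ1 _ hk, hdχ1 _ hk]
  -- The cutoff on `F` is removed first, with `R'` fixed, since the dominating function depends on
  -- `R'`; only then does `R'` tend to infinity.
  have hmain : ∀ R', 0 ≤ R' →
      0 < ∫ y in Metric.closedBall (0 : EuclideanSpace ℝ (Fin n)) R', Real.exp (-φ y) →
      Z * (Real.log (∫ y in Metric.closedBall (0 : EuclideanSpace ℝ (Fin n)) R',
        Real.exp (-φ y)) - Real.log Z) ≤ ∫ z, D z := by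
    intro R' hR' hpos
    refine le_of_tendsto_of_tendsto'
      (hFlim.mul (tendsto_const_nhds.sub (hFlim.log hZ.ne'))) (hPlim R' hR') fun k => ?_
    exact mul_log_sub_log_le_integral_cutoff hφ hs hf χ (by positivity) hR' hpos
      ((hbi R').mono' (hPmeas R' k) (ae_of_all _ (hPbound R' hR' k)))
  have hlim := (((hGlim.log one_ne_zero).sub_const (Real.log Z)).const_mul Z)
  have hle := le_of_tendsto hlim (by
    filter_upwards [hGlim.eventually (lt_mem_nhds one_pos)] with k hk
    exact hmain k (Nat.cast_nonneg k) hk)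
  simpa using hle

/-! ### The entropy inequality -/

theorem mainTheorem1 (n : ℕ) (φ : EuclideanSpace ℝ (Fin n) → ℝ)
    (hφ_smooth : ContDiff ℝ 1 φ)
    (hφ_convex : StrictConvexOn ℝ Set.univ φ)
    (hφ_superlinear : IsSuperlinear φ)
    (hφ_prob : ∫ x, Real.exp (-φ x) = 1)
    (g : EuclideanSpace ℝ (Fin n) → ℝ)
    (hg_smooth : ContDiff ℝ 1 g)
    (hg_exp : Integrable (fun x => Real.exp (g x)) (expMeasure φ))
    (hg_ent : Integrable (fun x => g x * Real.exp (g x)) (expMeasure φ))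
    (hg_rhs : Integrable (fun x =>
      (inner ℝ x (∇ g x) - legendreTransform φ (∇ φ x)
        + legendreTransform φ (∇ φ x - ∇ g x)) * Real.exp (g x)) (expMeasure φ)) :
    entropy (expMeasure φ) (fun x => Real.exp (g x)) ≤
      ∫ x, (inner ℝ x (∇ g x) - legendreTransform φ (∇ φ x)
        + legendreTransform φ (∇ φ x - ∇ g x)) * Real.exp (g x) ∂(expMeasure φ) := by
  have hφd : Differentiable ℝ φ := hφ_smooth.differentiable one_ne_zero
  have hgd : Differentiable ℝ g := hg_smooth.differentiable one_ne_zero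
  have hφc := hφ_smooth.continuous
  have hdens : Measurable fun x => ENNReal.ofReal (Real.exp (-φ x)) :=
    (by fun_prop : Continuous fun x => Real.exp (-φ x)).measurable.ennreal_ofReal
  have hint : ∀ u : EuclideanSpace ℝ (Fin n) → ℝ,
      ∫ x, u x ∂(expMeasure φ) = ∫ x, Real.exp (-φ x) * u x := by
    intro u
    rw [expMeasure, integral_withDensity_eq_integral_toReal_smul hdens (by simp)]
    simp [ENNReal.toReal_ofReal (Real.exp_nonneg _)]
  have hintegrable : ∀ u : EuclideanSpace ℝ (Fin n) → ℝ,
      Integrable u (expMeasure φ) → Integrable fun x => Real.exp (-φ x) * u x := by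
    intro u hu
    rw [expMeasure, integrable_withDensity_iff_integrable_smul' hdens (by simp)] at hu
    simpa [ENNReal.toReal_ofReal (Real.exp_nonneg _)] using hu
  set f : EuclideanSpace ℝ (Fin n) → ℝ := fun x => φ x - g x with hf_def
  have hf : ContDiff ℝ 1 f := hφ_smooth.sub hg_smooth
  have hgrad : ∀ x, ∇ f x = ∇ φ x - ∇ g x := by
    intro x
    simp only [gradient, hf_def]
    rw [fderiv_fun_sub (hφd x) (hgd x), map_sub]
  have hexp : ∀ x, Real.exp (-f x) = Real.exp (-φ x) * Real.exp (g x) := by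
    intro x
    rw [← Real.exp_add]
    congr 1
    simp only [hf_def]
    ring
  have hfi : Integrable fun x => Real.exp (-f x) := by
    simpa only [hexp] using hintegrable _ hg_exp
  -- With `φ*(∇φ) = x·∇φ - φ`, one has `f - x·∇f = x·∇g - φ*(∇φ) - g`; the last term supplies the `∫
  -- g e^g` part of the entropy.
  have hD : ∀ x, (f x - inner ℝ x (∇ f x) + legendreTransform φ (∇ f x)) * Real.exp (-f x) =
      Real.exp (-φ x) * ((inner ℝ x (∇ g x) - legendreTransform φ (∇ φ x)
        + legendreTransform φ (∇ φ x - ∇ g x)) * Real.exp (g x)) -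
      Real.exp (-φ x) * (g x * Real.exp (g x)) := by
    intro x
    rw [legendreTransform_gradient hφ_convex.convexOn hφd hφ_superlinear, hgrad, inner_sub_right,
      hexp]
    simp only [hf_def]
    ring
  have hDi : Integrable fun x =>
      (f x - inner ℝ x (∇ f x) + legendreTransform φ (∇ f x)) * Real.exp (-f x) := by
    simp only [hD]
    exact (hintegrable _ hg_rhs).sub (hintegrable _ hg_ent)
  have key := neg_integral_mul_log_integral_le hφc hφ_superlinear hφ_prob hf hfi hDi
  simp only [hD] at key
  rw [integral_sub (hintegrable _ hg_rhs) (hintegrable _ hg_ent)] at key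
  simp only [hexp] at key
  rw [← hint, ← hint, ← hint] at key
  have hZ : 0 < ∫ x, Real.exp (g x) ∂(expMeasure φ) := by
    rw [hint]
    simpa only [hexp] using integral_exp_pos hfi
  have hent : entropy (expMeasure φ) (fun x => Real.exp (g x)) =
      ∫ x, g x * Real.exp (g x) ∂(expMeasure φ) -
        (∫ x, Real.exp (g x) ∂(expMeasure φ)) *
          Real.log (∫ x, Real.exp (g x) ∂(expMeasure φ)) := by
    rw [entropy, ← integral_mul_const, ← integral_sub hg_ent (hg_exp.mul_const _)]
    congr with x
    rw [Real.log_div (Real.exp_ne_zero _) hZ.ne', Real.log_exp]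
    ring
  rw [hent]
  linarith
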